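/- Let $\mathcal H$ be a complex Hilbert space of finite dimension $L$, let $\mathcal F=\bigoplus_{N=0}^{L}\bigwedge^N\mathcal H$ be its fermionic Fock space with the inner product in which the sectors $\bigwedge^N\mathcal H$ are mutually orthogonal and $\langle v_1\wedge\dots\wedge v_N,\,w_1\wedge\dots\wedge w_N\rangle=\det(\langle v_i,w_j\rangle)$, and let $H:\mathcal F\to\mathcal F$ be a self-adjoint linear operator that conserves the particle number, i.e. maps each $\bigwedge^N\mathcal H$ into itself. For an orthonormal basis $\varphi=(\varphi_1,\dots,\varphi_L)$ of $\mathcal H$ and $\mu\in\{0,1\}^L$ let $\Phi^{\varphi}_{\mu}$ be the wedge product, in increasing order of $i$, of those $\varphi_i$ with $\mu_i=1$. Let $\mathrm{MPS}_3(\varphi)\subseteq\mathcal F$ be the set of matrix product states with bond dimensions $r_1=\dots=r_{L-1}=3$, i.e. of all states $$\Psi=\sum_{\mu\in\{0,1\}^L}A_1[\mu_1]A_2[\mu_2]\cdots A_L[\mu_L]\;\Phi^{\varphi}_{\mu},$$ where $A_i[0],A_i[1]$ are complex $r_{i-1}\times r_i$ matrices and $r_0=r_L=1$. Two-particle QC-DMRG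 with fermionic mode optimization, at bond dimension $3$, is the following scheme. Given the states $\Psi_0,\dots,\Psi_{j-1}$ selected at the lower levels, put for each orthonormal basis $\varphi$ $$E_j(\varphi)=\min\Bigl\{\tfrac{\langle\Psi,H\Psi\rangle}{\langle\Psi,\Psi\rangle}\;:\;\Psi\in\mathrm{MPS}_3(\varphi)\cap\textstyle\bigwedge^2\mathcal H,\ \Psi\ne0,\ \langle\Psi_k,\Psi\rangle=0\ \text{for all } k<j\Bigr\},\qquad E_j^{\mathrm{MO}}=\min_{\varphi}E_j(\varphi),$$ the second minimum being over those orthonormal bases $\varphi$ for which $E_j(\varphi)$ exists, and let $\Psi_j$ be any optimizer, i.e. any state that attains the minimum defining $E_j(\varphi)$ for some $\varphi$ with $E_j(\varphi)=E_j^{\mathrm{MO}}$. Let $E_0\le E_1\le\dots\le E_{\binom L2-1}$ be the exact (full configuration interaction, FCI) two-particle energies, i.e. the eigenvalues of $H$ restricted to $\bigwedge^2\mathcal H$, counted with multiplicity. Then the scheme is exact. For every $0\le j<\binom L2$ there are successive optimizers $\Psi_0,\dots,\Psi_j$. Moreover, for every $j\ge0$ and every choice of successive optimizers $\Psi_0,\dots,\Psi_{j-1}$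 at the lower levels, $E_j^{\mathrm{MO}}$ exists if and only if $E_j$ exists (i.e. $j<\binom L2$), in which case $$E_j^{\mathrm{MO}}=E_j,$$ and every corresponding optimizer $\Psi_j$ is an exact eigenstate: $H\Psi_j=E_j\Psi_j$. -/

import Mathlib

open scoped ComplexConjugate

noncomputable section

namespace QCDMRG

variable {E : Type*} [NormedAddCommGroup E] [InnerProductSpace ℂ E]

/-! ### Fermionic Fock space -/

/-- The fermionic Fock space `⨁ N, ⋀^N E` over the single-particle space `E`, realised as the
exterior algebra. Its `N`-particle sector is the submodule `⋀[ℂ]^N E`. The summands with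
`N > dim E` vanish. -/
abbrev Fock (E : Type*) [NormedAddCommGroup E] [InnerProductSpace ℂ E] : Type _ :=
  ExteriorAlgebra ℂ E

/-- The annihilation operator `a(v)`: contraction with the functional `⟨v, ·⟩`. It is
conjugate linear in `v`, and
`a(v) (w₁ ∧ ⋯ ∧ wₙ) = ∑ i, (-1)^(i-1) ⟨v, wᵢ⟩ w₁ ∧ ⋯ (omit wᵢ) ⋯ ∧ wₙ`. -/
def annihilation : E →ₗ⋆[ℂ] Module.End ℂ (Fock E) :=
  (CliffordAlgebra.contractLeft (Q := (0 : QuadraticForm ℂ E))).comp (innerₛₗ ℂ)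

/-- Precomposition with `a(w)` on conjugate-linear functionals; this is linear in `w`. -/
def precompAnnihilation : E →ₗ[ℂ] Module.End ℂ (Fock E →ₗ⋆[ℂ] ℂ) where
  toFun w :=
    { toFun := fun f => f.comp (annihilation w)
      map_add' := fun _ _ => rfl
      map_smul' := fun _ _ => rfl }
  map_add' v w := by
    ext f x
    simp
  map_smul' c w := by
    ext f x
    simp

theorem precompAnnihilation_sq (w : E) :
    precompAnnihilation w * precompAnnihilation w = 0 := by
  ext f x
  have h : annihilation w (annihilation w x) = 0 :=
    CliffordAlgebra.contractLeft_contractLeft (Q := (0 : QuadraticForm ℂ E)) _ _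
  change f (annihilation w (annihilation w x)) = 0
  rw [h, map_zero]

/-- The conjugate-linear functional `Ψ ↦ conj (vacuum component of Ψ)`, that is `⟨·, Ω⟩`. -/
def vacuumFunctional : Fock E →ₗ⋆[ℂ] ℂ where
  toFun x := conj (ExteriorAlgebra.algebraMapInv x)
  map_add' := by simp
  map_smul' := by simp

/-- The inner product `⟨Ψ, Φ⟩` on Fock space (conjugate linear in `Ψ`, linear in `Φ`): the
sesquilinear form with `⟨Ψ, Ω⟩ = conj (vacuum component of Ψ)` in which wedging with `w` from the
left is the adjoint of `a(w)`. The sectors are mutually orthogonal and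
`⟨v₁ ∧ ⋯ ∧ vₙ, w₁ ∧ ⋯ ∧ wₙ⟩ = det (⟨vᵢ, wⱼ⟩)`. -/
def fockInner (Ψ Φ : Fock E) : ℂ :=
  ExteriorAlgebra.lift ℂ ⟨precompAnnihilation, precompAnnihilation_sq⟩ Φ vacuumFunctional Ψ

theorem fockInner_one (Ψ : Fock E) :
    fockInner Ψ 1 = conj (ExteriorAlgebra.algebraMapInv Ψ) := by
  simp [fockInner, vacuumFunctional]

theorem fockInner_ι_mul (Ψ Φ : Fock E) (w : E) :
    fockInner Ψ (ExteriorAlgebra.ι ℂ w * Φ) = fockInner (annihilation w Ψ) Φ := by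
  simp [fockInner, precompAnnihilation]

/-- Self-adjointness of an operator on Fock space. -/
def IsSelfAdjointOp (H : Module.End ℂ (Fock E)) : Prop :=
  ∀ Ψ Φ : Fock E, fockInner (H Ψ) Φ = fockInner Ψ (H Φ)

/-- Particle number conservation: every `N`-particle sector is invariant. -/
def IsNumberConserving (H : Module.End ℂ (Fock E)) : Prop :=
  ∀ N : ℕ, ∀ Ψ ∈ ⋀[ℂ]^N E, H Ψ ∈ ⋀[ℂ]^N E

/-- The Rayleigh quotient `⟨Ψ, H Ψ⟩ / ⟨Ψ, Ψ⟩` (of interest for self-adjoint `H` and `Ψ ≠ 0`). -/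
def rayleigh (H : Module.End ℂ (Fock E)) (Ψ : Fock E) : ℝ :=
  (fockInner Ψ (H Ψ)).re / (fockInner Ψ Ψ).re

/-! ### Matrix product states -/

/-- The Slater determinant `Φ_{μ₁…μ_L}`: the wedge product, in increasing order, of the occupied
orbitals, that is of those `b i` with `μ i = 1`. -/
def slater {L : ℕ} (b : OrthonormalBasis (Fin L) ℂ E) (μ : Fin L → Fin 2) : Fock E :=
  (List.ofFn fun i => if μ i = 1 then ExteriorAlgebra.ι ℂ (b i) else 1).prod

/-- The bond dimensions `r₀, r₁, …, r_L`, with the convention `r₀ = r_L = 1`. -/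
def bondDim (L : ℕ) (r : ℕ → ℕ) (i : Fin (L + 1)) : ℕ :=
  if i = 0 ∨ i = Fin.last L then 1 else r i

/-- The entry of the `1 × 1` matrix `A₁[μ₁] A₂[μ₂] ⋯ A_L[μ_L]`, as a sum over all indices. -/
def mpsCoeff {L : ℕ} {r : ℕ → ℕ}
    (A : (i : Fin L) → Fin 2 →
      Matrix (Fin (bondDim L r i.castSucc)) (Fin (bondDim L r i.succ)) ℂ)
    (μ : Fin L → Fin 2) : ℂ :=
  ∑ α : (i : Fin (L + 1)) → Fin (bondDim L r i), ∏ i : Fin L, A i (μ i) (α i.castSucc) (α i.succ)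

/-- The set of matrix product states with respect to the basis `b`, with bond dimensions `r i`,
`1 ≤ i ≤ L - 1`. -/
def mpsSet {L : ℕ} (r : ℕ → ℕ) (b : OrthonormalBasis (Fin L) ℂ E) : Set (Fock E) :=
  {Ψ | ∃ A : (i : Fin L) → Fin 2 →
      Matrix (Fin (bondDim L r i.castSucc)) (Fin (bondDim L r i.succ)) ℂ,
    Ψ = ∑ μ : Fin L → Fin 2, mpsCoeff A μ • slater b μ}

/-! ### QC-DMRG, mode optimization, and full configuration interaction -/

/-- The trial states at level `j` in the basis `b`: nonzero `N`-particle matrix product states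
that are orthogonal to the states `Ψ 0, …, Ψ (j - 1)` of the lower levels. -/
def trialSet {L : ℕ} (r : ℕ → ℕ) (N : ℕ) (Ψ : ℕ → Fock E) (j : ℕ)
    (b : OrthonormalBasis (Fin L) ℂ E) : Set (Fock E) :=
  {Φ | Φ ∈ mpsSet r b ∧ Φ ≠ 0 ∧ Φ ∈ ⋀[ℂ]^N E ∧ ∀ k < j, fockInner (Ψ k) Φ = 0}

/-- `e` is the `j`-th QC-DMRG energy in the basis `b`, given the states of the lower levels. -/
def IsEnergy {L : ℕ} (H : Module.End ℂ (Fock E)) (r : ℕ → ℕ) (N : ℕ) (Ψ : ℕ → Fock E) (j : ℕ)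
    (b : OrthonormalBasis (Fin L) ℂ E) (e : ℝ) : Prop :=
  IsLeast (rayleigh H '' trialSet r N Ψ j b) e

/-- `e` is the `j`-th mode-optimized QC-DMRG energy, given the states of the lower levels: the
minimum, over all orthonormal bases, of the QC-DMRG energy in the basis. -/
def IsEnergyMO (H : Module.End ℂ (Fock E)) (r : ℕ → ℕ) (N : ℕ) (Ψ : ℕ → Fock E) (j : ℕ)
    (e : ℝ) : Prop :=
  IsLeast {e' : ℝ | ∃ b : OrthonormalBasis (Fin (Module.finrank ℂ E)) ℂ E,
    IsEnergy H r N Ψ j b e'} e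

/-- `Φ` is a `j`-th optimizer of mode-optimized QC-DMRG, given the states of the lower levels: an
optimizer of QC-DMRG in an optimal basis. -/
def IsOptimizerMO (H : Module.End ℂ (Fock E)) (r : ℕ → ℕ) (N : ℕ) (Ψ : ℕ → Fock E) (j : ℕ)
    (Φ : Fock E) : Prop :=
  ∃ b : OrthonormalBasis (Fin (Module.finrank ℂ E)) ℂ E,
    Φ ∈ trialSet r N Ψ j b ∧ IsEnergy H r N Ψ j b (rayleigh H Φ) ∧
      IsEnergyMO H r N Ψ j (rayleigh H Φ)

/-- `Ψ 0, …, Ψ (n - 1)` are successive optimizers of mode-optimized QC-DMRG. -/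
def IsRunMO (H : Module.End ℂ (Fock E)) (r : ℕ → ℕ) (N : ℕ) (Ψ : ℕ → Fock E) (n : ℕ) : Prop :=
  ∀ k < n, IsOptimizerMO H r N Ψ k (Ψ k)

/-- `e` is the `j`-th exact (full configuration interaction) `N`-particle energy: the eigenvalue
with index `j` when the eigenvalues of `H` on the `N`-particle sector are listed in increasing
order with multiplicity, `E₀ ≤ E₁ ≤ ⋯`. That is, at most `j` eigenvalues are `< e` and more than
`j` are `≤ e`, counted with multiplicity. -/
def IsExactEnergy (H : Module.End ℂ (Fock E)) (N j : ℕ) (e : ℝ) : Prop :=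
  Module.finrank ℂ ↥(⨆ x : ℝ, ⨆ _ : x < e, (⋀[ℂ]^N E ⊓ Module.End.eigenspace H (x : ℂ))) ≤ j ∧
    j < Module.finrank ℂ ↥(⨆ x : ℝ, ⨆ _ : x ≤ e, (⋀[ℂ]^N E ⊓ Module.End.eigenspace H (x : ℂ)))

end QCDMRG

end

open scoped ComplexConjugate

noncomputable section

namespace QCDMRG

variable {E : Type*} [NormedAddCommGroup E] [InnerProductSpace ℂ E]

/-! ### The inner product on the two-particle sector -/

/-! The point is that every two-particle state lies in `mpsSet (fun _ => 3) b` for a suitable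
orthonormal basis `b`. Its amplitudes form an alternating bilinear form, which a Lanczos-type choice
of basis makes tridiagonal (`exists_orthonormalBasis_tridiagonal`). The state is then a
superposition of nearest-neighbour pairs `b i ∧ b (i + 1)`, and bond dimension three suffices for
these: a bond only has to remember whether no particle, one particle or the whole pair has been
passed (`exists_mem_mpsSet`).

Minimizing over bases is therefore the same as minimizing the energy over all two-particle states
orthogonal to the lower levels. By induction the lower optimizers are eigenvectors, so this
orthogonal complement is invariant under `H`; a minimizer there exists and is an eigenvector
(`exists_eigenvector_le_re_inner`, `eq_smul_of_re_inner_eq`). Counting eigenvectors below and up to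
the minimum identifies it with the exact energy of index `j` (`IsGroundState.isExactEnergy`). -/

theorem fockInner_add_left (Ψ₁ Ψ₂ Φ : Fock E) :
    fockInner (Ψ₁ + Ψ₂) Φ = fockInner Ψ₁ Φ + fockInner Ψ₂ Φ :=
  map_add _ _ _

theorem fockInner_smul_left (c : ℂ) (Ψ Φ : Fock E) :
    fockInner (c • Ψ) Φ = conj c * fockInner Ψ Φ :=
  LinearMap.map_smulₛₗ _ _ _

theorem fockInner_add_right (Ψ Φ₁ Φ₂ : Fock E) :
    fockInner Ψ (Φ₁ + Φ₂) = fockInner Ψ Φ₁ + fockInner Ψ Φ₂ := by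
  simp [fockInner]

theorem fockInner_smul_right (c : ℂ) (Ψ Φ : Fock E) :
    fockInner Ψ (c • Φ) = c * fockInner Ψ Φ := by
  simp [fockInner]

theorem fockInner_zero_right (Ψ : Fock E) : fockInner Ψ 0 = 0 := by
  simp [fockInner]

theorem fockInner_sum_right {ι : Type*} (s : Finset ι) (Ψ : Fock E) (Φ : ι → Fock E) :
    fockInner Ψ (∑ i ∈ s, Φ i) = ∑ i ∈ s, fockInner Ψ (Φ i) := by
  simp [fockInner]

theorem annihilation_ι_mul (v w : E) (Ψ : Fock E) :
    annihilation v (ExteriorAlgebra.ι ℂ w * Ψ) =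
      inner ℂ v w • Ψ - ExteriorAlgebra.ι ℂ w * annihilation v Ψ :=
  CliffordAlgebra.contractLeft_ι_mul (Q := (0 : QuadraticForm ℂ E)) (innerₛₗ ℂ v) w Ψ

theorem annihilation_ι (v w : E) :
    annihilation v (ExteriorAlgebra.ι ℂ w) = algebraMap ℂ (Fock E) (inner ℂ v w) :=
  CliffordAlgebra.contractLeft_ι (Q := (0 : QuadraticForm ℂ E)) (innerₛₗ ℂ v) w

theorem fockInner_ι_mul_ι (x y v w : E) :
    fockInner (ExteriorAlgebra.ι ℂ x * ExteriorAlgebra.ι ℂ y)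
        (ExteriorAlgebra.ι ℂ v * ExteriorAlgebra.ι ℂ w) =
      inner ℂ x v * inner ℂ y w - inner ℂ x w * inner ℂ y v := by
  rw [fockInner_ι_mul, ← mul_one (ExteriorAlgebra.ι ℂ w), fockInner_ι_mul, fockInner_one,
    annihilation_ι_mul, annihilation_ι, map_sub, map_smul, annihilation_ι,
    ← Algebra.commutes, ← Algebra.smul_def, map_smul, annihilation_ι]
  simp only [map_sub, map_smul, smul_eq_mul, map_mul, inner_conj_symm,
    (ExteriorAlgebra.algebraMap_leftInverse (R := ℂ) E) _]
  ring

/-- The bilinear form `(v, w) ↦ ⟨Ψ, v ∧ w⟩`. -/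
def pairForm (Ψ : Fock E) : E →ₗ[ℂ] E →ₗ[ℂ] ℂ :=
  LinearMap.mk₂ ℂ
    (fun v w => fockInner Ψ (ExteriorAlgebra.ι ℂ v * ExteriorAlgebra.ι ℂ w))
    (fun _ _ _ => by rw [map_add, add_mul, fockInner_add_right])
    (fun _ _ _ => by rw [map_smul, smul_mul_assoc, fockInner_smul_right, smul_eq_mul])
    (fun _ _ _ => by rw [map_add, mul_add, fockInner_add_right])
    (fun _ _ _ => by rw [map_smul, mul_smul_comm, fockInner_smul_right, smul_eq_mul])

theorem pairForm_apply (Ψ : Fock E) (v w : E) :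
    pairForm Ψ v w = fockInner Ψ (ExteriorAlgebra.ι ℂ v * ExteriorAlgebra.ι ℂ w) := rfl

theorem pairForm_self (Ψ : Fock E) (v : E) : pairForm Ψ v v = 0 := by
  rw [pairForm_apply, ExteriorAlgebra.ι_sq_zero, fockInner_zero_right]

@[elab_as_elim]
theorem exteriorPower_two_induction {p : Fock E → Prop}
    (mul : ∀ v w, p (ExteriorAlgebra.ι ℂ v * ExteriorAlgebra.ι ℂ w))
    (add : ∀ x y, p x → p y → p (x + y)) (Ψ : Fock E) (hΨ : Ψ ∈ ⋀[ℂ]^2 E) : p Ψ := by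
  rw [ExteriorAlgebra.exteriorPower, pow_two] at hΨ
  refine Submodule.mul_induction_on hΨ ?_ add
  rintro _ ⟨v, rfl⟩ _ ⟨w, rfl⟩
  exact mul v w

/-- The expansion of a two-particle state in an orthonormal basis. -/
theorem sum_pairForm_smul {ι : Type*} [Fintype ι] (b : OrthonormalBasis ι ℂ E) {Ψ : Fock E}
    (hΨ : Ψ ∈ ⋀[ℂ]^2 E) :
    ∑ i, ∑ j, conj (pairForm Ψ (b i) (b j)) •
      (ExteriorAlgebra.ι ℂ (b i) * ExteriorAlgebra.ι ℂ (b j)) = (2 : ℂ) • Ψ := by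
  refine exteriorPower_two_induction (fun v w => ?_) (fun x y hx hy => ?_) Ψ hΨ
  swap
  · simp only [pairForm_apply, fockInner_add_left, map_add, add_smul, Finset.sum_add_distrib,
      smul_add] at hx hy ⊢
    rw [hx, hy]
  · have key (v w : E) : ∑ i, ∑ j, (inner ℂ (b i) v * inner ℂ (b j) w) •
        (ExteriorAlgebra.ι ℂ (b i) * ExteriorAlgebra.ι ℂ (b j)) =
          ExteriorAlgebra.ι ℂ v * ExteriorAlgebra.ι ℂ w := by
      conv_rhs => rw [← b.sum_repr' v, ← b.sum_repr' w]
      simp only [map_sum, map_smul, Finset.sum_mul_sum, smul_mul_smul_comm]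
    simp only [pairForm_apply, fockInner_ι_mul_ι, map_sub, map_mul, inner_conj_symm, sub_smul,
      Finset.sum_sub_distrib]
    rw [key v w]
    -- The exchange term of the determinant gives `w ∧ v = -(v ∧ w)`, hence the factor `2`.
    have h : ∑ i, ∑ j, (inner ℂ (b j) v * inner ℂ (b i) w) •
        (ExteriorAlgebra.ι ℂ (b i) * ExteriorAlgebra.ι ℂ (b j)) =
          ExteriorAlgebra.ι ℂ w * ExteriorAlgebra.ι ℂ v := by
      rw [← key w v]
      simp only [mul_comm (inner ℂ _ v)]
    rw [h, two_smul, eq_neg_of_add_eq_zero_left (ExteriorAlgebra.ι_add_mul_swap w v),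
      sub_neg_eq_add]

theorem two_mul_fockInner {ι : Type*} [Fintype ι] (b : OrthonormalBasis ι ℂ E) (Ψ : Fock E)
    {Φ : Fock E} (hΦ : Φ ∈ ⋀[ℂ]^2 E) :
    2 * fockInner Ψ Φ =
      ∑ i, ∑ j, conj (pairForm Φ (b i) (b j)) * pairForm Ψ (b i) (b j) := by
  rw [← fockInner_smul_right, ← sum_pairForm_smul b hΦ]
  simp only [fockInner_sum_right, fockInner_smul_right, pairForm_apply]

theorem fockInner_conj_symm [FiniteDimensional ℂ E] {Ψ Φ : Fock E} (hΨ : Ψ ∈ ⋀[ℂ]^2 E)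
    (hΦ : Φ ∈ ⋀[ℂ]^2 E) : conj (fockInner Φ Ψ) = fockInner Ψ Φ := by
  have b := stdOrthonormalBasis ℂ E
  refine mul_left_cancel₀ (two_ne_zero (α := ℂ)) ?_
  rw [two_mul_fockInner b Ψ hΦ, ← Complex.conj_ofNat 2, ← map_mul, two_mul_fockInner b Φ hΨ]
  simp [mul_comm]

/-- Parseval's identity for pairs; it is the source of positivity and definiteness on the
two-particle sector. -/
theorem two_mul_re_fockInner_self {ι : Type*} [Fintype ι] (b : OrthonormalBasis ι ℂ E)
    {Ψ : Fock E} (hΨ : Ψ ∈ ⋀[ℂ]^2 E) :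
    2 * (fockInner Ψ Ψ).re = ∑ i, ∑ j, ‖pairForm Ψ (b i) (b j)‖ ^ 2 := by
  have h := congrArg Complex.re (two_mul_fockInner b Ψ hΨ)
  simp only [Complex.conj_mul'] at h
  norm_cast at h
  simpa using h

theorem re_fockInner_self_nonneg [FiniteDimensional ℂ E] {Ψ : Fock E} (hΨ : Ψ ∈ ⋀[ℂ]^2 E) :
    0 ≤ (fockInner Ψ Ψ).re := by
  have h := two_mul_re_fockInner_self (stdOrthonormalBasis ℂ E) hΨ
  have : 0 ≤ 2 * (fockInner Ψ Ψ).re := by rw [h]; positivity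
  linarith

theorem eq_zero_of_fockInner_self [FiniteDimensional ℂ E] {Ψ : Fock E} (hΨ : Ψ ∈ ⋀[ℂ]^2 E)
    (h0 : fockInner Ψ Ψ = 0) : Ψ = 0 := by
  have h := two_mul_re_fockInner_self (stdOrthonormalBasis ℂ E) hΨ
  rw [h0, Complex.zero_re, mul_zero, eq_comm,
    Finset.sum_eq_zero_iff_of_nonneg fun _ _ => by positivity] at h
  have h' : (2 : ℂ) • Ψ = 0 := by
    rw [← sum_pairForm_smul (stdOrthonormalBasis ℂ E) hΨ]
    refine Finset.sum_eq_zero fun i hi => Finset.sum_eq_zero fun j hj => ?_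
    have := h i hi
    rw [Finset.sum_eq_zero_iff_of_nonneg fun _ _ => by positivity] at this
    rw [norm_eq_zero.1 (pow_eq_zero_iff two_ne_zero |>.1 (this j hj)), map_zero, zero_smul]
  exact (smul_eq_zero.1 h').resolve_left two_ne_zero

/-- The two-particle sector as an inner product space. -/
abbrev pairCore (E : Type*) [NormedAddCommGroup E] [InnerProductSpace ℂ E]
    [FiniteDimensional ℂ E] : InnerProductSpace.Core ℂ (⋀[ℂ]^2 E) where
  inner x y := fockInner (x : Fock E) y
  conj_inner_symm x y := fockInner_conj_symm x.2 y.2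
  re_inner_nonneg x := re_fockInner_self_nonneg x.2
  add_left _ _ _ := fockInner_add_left _ _ _
  smul_left _ _ _ := fockInner_smul_left _ _ _
  definite x hx := Subtype.ext (eq_zero_of_fockInner_self x.2 hx)

/-! ### Tridiagonal form of alternating bilinear forms -/

/-- Lanczos recursion: on the complement of `u` the functional `B u` is `⟨z, ·⟩`, so it vanishes on
everything orthogonal to `z`. Taking the direction of `z` as the next basis vector settles the row
of `u`. Prescribing the initial vector is what lets the induction continue. -/
theorem exists_orthonormalBasis_tridiagonal (n : ℕ) {E : Type*} [NormedAddCommGroup E]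
    [InnerProductSpace ℂ E] [FiniteDimensional ℂ E] (hn : Module.finrank ℂ E = n + 1)
    (B : E →ₗ[ℂ] E →ₗ[ℂ] ℂ) (u : E) (hu : ‖u‖ = 1) :
    ∃ b : OrthonormalBasis (Fin (n + 1)) ℂ E, b 0 = u ∧
      ∀ i j : Fin (n + 1), (i : ℕ) + 1 < j → B (b i) (b j) = 0 := by
  induction n generalizing E with
  | zero =>
    obtain ⟨b, hb⟩ := Orthonormal.exists_orthonormalBasis_extension_of_card_eq
      (ι := Fin (0 + 1)) (𝕜 := ℂ) (by simpa using hn) (v := fun _ => u) (s := Set.univ)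
      ⟨fun _ => hu, fun i j h =>
        (h (Subtype.ext (Fin.ext (by omega)))).elim⟩
    exact ⟨b, hb 0 trivial, fun i j h => by omega⟩
  | succ n ih =>
    have hu0 : u ≠ 0 := by rintro rfl; simp at hu
    let K : Submodule ℂ E := (Submodule.span ℂ {u})ᗮ
    have hK : Module.finrank ℂ K = n + 1 := by
      have := Submodule.finrank_add_finrank_orthogonal (Submodule.span ℂ {u})
      rw [finrank_span_singleton hu0, hn] at this
      change Module.finrank ℂ (Submodule.span ℂ {u})ᗮ = n + 1
      omega
    let z : K := (InnerProductSpace.toDual ℂ K).symm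
      (LinearMap.toContinuousLinearMap (B u ∘ₗ K.subtype))
    have hz (w : K) : inner ℂ z w = B u w := by
      simp [z]
    -- If `z = 0`, the row of `u` already vanishes on `K` and any unit vector serves, with `c = 0`.
    obtain ⟨v, hv, hvz⟩ : ∃ v : K, ‖v‖ = 1 ∧ ∃ c : ℂ, z = c • v := by
      by_cases h : z = 0
      · have : Nontrivial K := Module.nontrivial_of_finrank_pos (R := ℂ) (by omega)
        obtain ⟨v, hv⟩ := exists_norm_eq K zero_le_one
        exact ⟨v, hv, 0, by simpa using h⟩
      · refine ⟨((‖z‖⁻¹ : ℝ) : ℂ) • z, ?_, ‖z‖, ?_⟩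
        · simp [norm_smul, h]
        · rw [smul_smul]
          simp [h]
    obtain ⟨c, hc⟩ := hvz
    obtain ⟨b', hb0, hb'⟩ := ih hK (B.compl₁₂ K.subtype K.subtype) v hv
    have horth : Orthonormal ℂ (Fin.cons u (fun i => (b' i : E)) : Fin (n + 1 + 1) → E) := by
      have hub (i) : inner ℂ u (b' i : E) = 0 :=
        (b' i).2 u (Submodule.mem_span_singleton_self u)
      refine ⟨fun i => ?_, fun i j => ?_⟩
      · refine Fin.cases hu (fun i => ?_) i
        exact b'.orthonormal.1 i
      · refine Fin.cases ?_ (fun i => ?_) i <;> refine Fin.cases ?_ (fun j => ?_) j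
        · exact fun h => (h rfl).elim
        · exact fun _ => hub j
        · exact fun _ => inner_eq_zero_symm.1 (hub i)
        · exact fun h => b'.orthonormal.2 (fun h' => h (congrArg Fin.succ h'))
    obtain ⟨b, hb⟩ := Orthonormal.exists_orthonormalBasis_extension_of_card_eq
      (ι := Fin (n + 1 + 1)) (𝕜 := ℂ) (by simpa using hn) (s := Set.univ)
      (horth.comp _ Subtype.val_injective)
    refine ⟨b, hb 0 trivial, fun i j => ?_⟩
    rw [hb i trivial, hb j trivial]
    refine Fin.cases ?_ (fun i => ?_) i <;> refine Fin.cases ?_ (fun j => ?_) j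
    · simp
    · intro h
      simp only [Fin.cons_zero, Fin.cons_succ]
      rw [← hz, hc, inner_smul_left, ← hb0, b'.orthonormal.2, mul_zero]
      rintro rfl
      simp at h
    · intro h
      simp at h
    · intro h
      exact hb' i j (by simpa using h)

/-! ### Two-particle states as matrix product states of bond dimension three -/

theorem prod_ofFn_pair {M : Type*} [Monoid M] {n : ℕ} (f : Fin n → M) (i : ℕ)
    (hi : i + 1 < n) (h : ∀ k : Fin n, (k : ℕ) ≠ i → (k : ℕ) ≠ i + 1 → f k = 1) :
    (List.ofFn f).prod = f ⟨i, by omega⟩ * f ⟨i + 1, hi⟩ := by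
  induction n generalizing i with
  | zero => omega
  | succ n ih =>
    rw [List.ofFn_succ, List.prod_cons]
    cases i with
    | zero =>
      obtain ⟨m, rfl⟩ : ∃ m, n = m + 1 := ⟨n - 1, by omega⟩
      rw [List.ofFn_succ, List.prod_cons, List.prod_eq_one, mul_one]
      · rfl
      · intro x hx
        obtain ⟨k, rfl⟩ := List.mem_ofFn.1 hx
        exact h _ (by simp) (by simp)
    | succ i =>
      rw [h 0 (by simp) (by simp), one_mul]
      exact ih (fun k => f k.succ) i (by omega) fun k h₁ h₂ =>
        h k.succ (by simpa using h₁) (by simpa using h₂)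

/-- The occupation numbers of the state in which the orbitals `i` and `i + 1` are occupied. -/
def pairOcc (L i : ℕ) (k : Fin L) : Fin 2 :=
  if (k : ℕ) = i ∨ (k : ℕ) = i + 1 then 1 else 0

theorem slater_pairOcc {n : ℕ} (b : OrthonormalBasis (Fin (n + 1)) ℂ E) (i : Fin n) :
    slater b (pairOcc (n + 1) i) =
      ExteriorAlgebra.ι ℂ (b i.castSucc) * ExteriorAlgebra.ι ℂ (b i.succ) := by
  rw [slater, prod_ofFn_pair _ i (by omega)]
  · simp only [pairOcc, true_or, or_true, if_true]
    rfl
  · intro k h₁ h₂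
    simp [pairOcc, h₁, h₂]

theorem pairOcc_injective {n : ℕ} :
    Function.Injective fun i : Fin n => pairOcc (n + 1) (i : ℕ) := by
  intro i j h
  have h₁ := congrFun h i.castSucc
  have h₂ := congrFun h i.succ
  simp only [pairOcc, Fin.val_castSucc, Fin.val_succ, true_or, or_true, if_true] at h₁ h₂
  split_ifs at h₁ h₂ <;> (ext; omega)

/-- The amplitude for the transition from bond state `s` to bond state `t` at a site with
amplitude `z` and occupation number `m`. The bond states `0`, `1`, `2` stand for: no particle so
far, one particle on the site just passed, two particles on neighbouring sites. -/
def pairStep (z : ℂ) (m : Fin 2) (s t : ℕ) : ℂ :=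
  if m = 0 then (if s = t ∧ s ≠ 1 then 1 else 0)
  else if s = 0 ∧ t = 1 then z else if s = 1 ∧ t = 2 then 1 else 0

/-- The bond state at bond `p` when the pair sits on the sites `i` and `i + 1`. -/
def pairState (i p : ℕ) : ℕ := if p ≤ i then 0 else if p = i + 1 then 1 else 2

theorem pairStep_ne_zero {z : ℂ} {m : Fin 2} {s t : ℕ} (h : pairStep z m s t ≠ 0) :
    (m = 0 ∧ s = t ∧ s ≠ 1) ∨ (m = 1 ∧ s = 0 ∧ t = 1) ∨ (m = 1 ∧ s = 1 ∧ t = 2) := by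
  unfold pairStep at h
  have : m = 0 ∨ m = 1 := by omega
  split_ifs at h with h₁ h₂ h₃ h₄
  · exact .inl ⟨h₁, h₂⟩
  · exact (h rfl).elim
  · exact .inr (.inl ⟨this.resolve_left h₁, h₃⟩)
  · exact .inr (.inr ⟨this.resolve_left h₁, h₄⟩)
  · exact (h rfl).elim

/-- The allowed transitions are `0 → 0`, `0 → 1`, `1 → 2`, `2 → 2`. State `1` cannot persist, so the
site at which a path leaves `0` determines all of it. -/
theorem exists_eq_pairState {L : ℕ} {z : ℕ → ℂ} {m : ℕ → Fin 2} {s : ℕ → ℕ} (h0 : s 0 = 0)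
    (hL : s L = 2) (h : ∀ k < L, pairStep (z k) (m k) (s k) (s (k + 1)) ≠ 0) :
    ∃ i, i + 1 < L ∧ (∀ p ≤ L, s p = pairState i p) ∧
      ∀ k < L, m k = if k = i ∨ k = i + 1 then 1 else 0 := by
  have hex : ∃ p, s (p + 1) ≠ 0 := by
    refine ⟨L - 1, ?_⟩
    have : L ≠ 0 := by rintro rfl; omega
    rw [Nat.sub_add_cancel (by omega)]
    omega
  obtain ⟨i, hi, hmin⟩ : ∃ i, s (i + 1) ≠ 0 ∧ ∀ q < i, s (q + 1) = 0 :=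
    ⟨Nat.find hex, Nat.find_spec hex, fun q hq => by simpa using Nat.find_min hex hq⟩
  have hle (p : ℕ) (hp : p ≤ i) : s p = 0 := by
    cases p with
    | zero => exact h0
    | succ q => exact hmin q (by omega)
  have hiL : i < L := by
    by_contra hcon
    have := hle L (by omega)
    omega
  have h1 := pairStep_ne_zero (h i hiL)
  have hi0 := hle i le_rfl
  -- The pair cannot begin on the last site: no single step leads from `0` to the final state `2`.
  have hi1 : i + 1 < L := by
    by_contra hcon
    have : i + 1 = L := by omega
    rw [this] at h1
    omega
  have h2 := pairStep_ne_zero (h (i + 1) hi1)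
  have hge (d : ℕ) (hd : i + 2 + d ≤ L) : s (i + 2 + d) = 2 := by
    induction d with
    | zero =>
      change s (i + 1 + 1) = 2
      omega
    | succ d ih =>
      have h3 := pairStep_ne_zero (h (i + 2 + d) (by omega))
      have := ih (by omega)
      rw [← add_assoc]
      omega
  have hs (p : ℕ) (hp : p ≤ L) : s p = pairState i p := by
    unfold pairState
    split_ifs with h₁ h₂
    · exact hle p h₁
    · subst h₂
      omega
    · have := hge (p - (i + 2)) (by omega)
      rwa [Nat.add_sub_cancel' (by omega)] at this
  refine ⟨i, hi1, hs, fun k hk => ?_⟩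
  have h3 := pairStep_ne_zero (h k hk)
  rw [hs k hk.le, hs (k + 1) hk] at h3
  unfold pairState at h3
  rcases h3 with ⟨hm, h3⟩ | ⟨hm, h3⟩ | ⟨hm, h3⟩ <;> rw [hm] <;> split_ifs at h3 ⊢ <;>
    first | rfl | omega | simp at h3

/-- The bond state encoded by a bond index: the outer bonds carry the states `0` and `2`. -/
def bondState {L : ℕ} (p : Fin (L + 1)) (a : Fin (bondDim L (fun _ => 3) p)) : ℕ :=
  if p = 0 then 0 else if p = Fin.last L then 2 else a

/-- The matrices of a superposition of nearest-neighbour pairs with amplitudes `z`. -/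
def pairMatrices (L : ℕ) (z : ℕ → ℂ) (i : Fin L) (m : Fin 2) :
    Matrix (Fin (bondDim L (fun _ => 3) i.castSucc)) (Fin (bondDim L (fun _ => 3) i.succ)) ℂ :=
  Matrix.of fun s t => pairStep (z i) m (bondState _ s) (bondState _ t)

/-- The path of bond indices of a pair on the sites `i` and `i + 1`. -/
def pairPath (L i : ℕ) (p : Fin (L + 1)) : Fin (bondDim L (fun _ => 3) p) :=
  ⟨if p = 0 ∨ p = Fin.last L then 0 else pairState i p, by
    unfold bondDim pairState
    by_cases hp : p = 0 ∨ p = Fin.last L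
    · simp [hp]
    · simp only [hp, if_false]
      split_ifs <;> omega⟩

theorem bondState_pairPath {L i : ℕ} (hi : i + 1 < L) (p : Fin (L + 1)) :
    bondState p (pairPath L i p) = pairState i p := by
  unfold bondState pairPath
  by_cases h₁ : p = 0
  · simp [h₁, pairState]
  by_cases h₂ : p = Fin.last L
  · subst h₂
    rw [if_neg h₁, if_pos rfl, Fin.val_last, pairState, if_neg (by omega), if_neg (by omega)]
  · simp [h₁, h₂]

theorem bondState_injective {L : ℕ} (p : Fin (L + 1)) : Function.Injective (bondState p) := by
  intro a a' h
  unfold bondState at h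
  have ha := a.2
  have ha' := a'.2
  ext
  by_cases hp : p = 0 ∨ p = Fin.last L
  · have : bondDim L (fun _ => 3) p = 1 := by simp [bondDim, hp]
    omega
  · rw [not_or] at hp
    simpa [hp] using h

theorem exists_of_prod_ne_zero {L : ℕ} (hL : L ≠ 0) {z : ℕ → ℂ} {μ : Fin L → Fin 2}
    {α : (p : Fin (L + 1)) → Fin (bondDim L (fun _ => 3) p)}
    (h : ∏ k : Fin L, pairMatrices L z k (μ k) (α k.castSucc) (α k.succ) ≠ 0) :
    ∃ i, i + 1 < L ∧ μ = pairOcc L i ∧ α = pairPath L i := by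
  rw [Finset.prod_ne_zero_iff] at h
  -- The data are extended to `ℕ` by the default `0`, which is never read within the relevant range.
  obtain ⟨i, hi, hs, hm⟩ := exists_eq_pairState (L := L) (z := z)
    (m := fun k => if hk : k < L then μ ⟨k, hk⟩ else 0)
    (s := fun p => if hp : p < L + 1 then bondState ⟨p, hp⟩ (α ⟨p, hp⟩) else 0)
    (by simp [bondState]) (by simp [bondState, Fin.last, hL])
    (fun k hk => by
      have := h ⟨k, hk⟩ (Finset.mem_univ _)
      rw [dif_pos hk, dif_pos (by omega), dif_pos (by omega)]
      exact this)
  refine ⟨i, hi, ?_, ?_⟩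
  · ext k : 1
    have := hm k k.2
    rwa [dif_pos k.2] at this
  · ext p : 1
    have := hs p (by omega)
    rw [dif_pos p.2] at this
    exact bondState_injective p (this.trans (bondState_pairPath hi p).symm)

theorem prod_pairPath {L i : ℕ} (hi : i + 1 < L) (z : ℕ → ℂ) :
    ∏ k : Fin L, pairMatrices L z k (pairOcc L i k) (pairPath L i k.castSucc)
      (pairPath L i k.succ) = z i := by
  simp only [pairMatrices, Matrix.of_apply, bondState_pairPath hi]
  -- Only the step `0 → 1` at site `i` carries the amplitude; every other factor is `1`.
  rw [Finset.prod_eq_single ⟨i, by omega⟩]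
  · simp [pairStep, pairOcc, pairState]
  · intro k _ hk
    have hk' : (k : ℕ) ≠ i := fun h => hk (Fin.ext h)
    simp only [pairStep, pairOcc, pairState, Fin.val_castSucc, Fin.val_succ]
    split_ifs <;> first | rfl | omega
  · simp

theorem mpsCoeff_pairMatrices (n : ℕ) (z : ℕ → ℂ) (μ : Fin (n + 1) → Fin 2) :
    mpsCoeff (pairMatrices (n + 1) z) μ =
      ∑ i : Fin n, if μ = pairOcc (n + 1) i then z i else 0 := by
  unfold mpsCoeff
  by_cases hμ : ∃ i : Fin n, μ = pairOcc (n + 1) i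
  · obtain ⟨i, rfl⟩ := hμ
    rw [Finset.sum_eq_single (pairPath (n + 1) i), prod_pairPath (by omega)]
    · simp [pairOcc_injective.eq_iff]
    · intro α _ hα
      by_contra hne
      obtain ⟨i', hi', hμ, rfl⟩ := exists_of_prod_ne_zero (by omega) hne
      have : i = ⟨i', by omega⟩ := pairOcc_injective hμ
      rw [this] at hα
      exact hα rfl
    · simp
  · rw [Finset.sum_eq_zero, Finset.sum_eq_zero]
    · exact fun i _ => if_neg fun h => hμ ⟨i, h⟩
    · intro α _
      by_contra hne
      obtain ⟨i', hi', rfl, -⟩ := exists_of_prod_ne_zero (by omega) hne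
      exact hμ ⟨⟨i', by omega⟩, rfl⟩

theorem sum_pairs_mem_mpsSet {n : ℕ} (b : OrthonormalBasis (Fin (n + 1)) ℂ E) (z : ℕ → ℂ) :
    ∑ i : Fin n, z i •
        (ExteriorAlgebra.ι ℂ (b i.castSucc) * ExteriorAlgebra.ι ℂ (b i.succ)) ∈
      mpsSet (fun _ => 3) b := by
  refine ⟨pairMatrices (n + 1) z, ?_⟩
  simp only [mpsCoeff_pairMatrices, Finset.sum_smul, ite_smul, zero_smul]
  rw [Finset.sum_comm]
  simp [slater_pairOcc]

/-- Meant for `F i j` an amplitude times a wedge product: both factors are antisymmetric, so `F` is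
symmetric. -/
theorem sum_sum_eq_of_tridiagonal {n : ℕ} {M : Type*} [AddCommMonoid M]
    (F : Fin (n + 1) → Fin (n + 1) → M) (hsymm : ∀ i j, F i j = F j i) (hdiag : ∀ i, F i i = 0)
    (htri : ∀ i j : Fin (n + 1), (i : ℕ) + 1 < j → F i j = 0) :
    ∑ i, ∑ j, F i j = 2 • ∑ i : Fin n, F i.castSucc i.succ := by
  have hF (i j) : F i j = (if (i : ℕ) + 1 = j then F i j else 0) +
      (if (j : ℕ) + 1 = i then F j i else 0) := by
    rcases lt_trichotomy (i : ℕ) j with h | h | h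
    · rw [if_neg (by omega : ¬ (j : ℕ) + 1 = i), add_zero]
      split_ifs with h'
      · rfl
      · exact htri i j (by omega)
    · rw [Fin.ext h, hdiag]
      simp
    · rw [if_neg (by omega : ¬ (i : ℕ) + 1 = j), zero_add]
      split_ifs with h'
      · exact hsymm i j
      · rw [hsymm]
        exact htri j i (by omega)
  have hG : ∑ i : Fin (n + 1), ∑ j : Fin (n + 1), (if (i : ℕ) + 1 = j then F i j else 0) =
      ∑ i : Fin n, F i.castSucc i.succ := by
    rw [Fin.sum_univ_castSucc]
    have hlast : ∑ j : Fin (n + 1),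
        (if (Fin.last n : ℕ) + 1 = j then F (Fin.last n) j else 0) = 0 :=
      Finset.sum_eq_zero fun j _ => if_neg (by simp; omega)
    rw [hlast, add_zero]
    refine Finset.sum_congr rfl fun i _ => ?_
    rw [Finset.sum_eq_single i.succ]
    · simp
    · intro j _ hj
      refine if_neg fun h => hj (Fin.ext ?_)
      simpa using h.symm
    · simp
  rw [Finset.sum_congr rfl fun i _ => Finset.sum_congr rfl fun j _ => hF i j]
  simp only [Finset.sum_add_distrib]
  rw [hG, Finset.sum_comm, hG, two_nsmul]

theorem exists_mem_mpsSet [FiniteDimensional ℂ E] {Ψ : Fock E} (hΨ : Ψ ∈ ⋀[ℂ]^2 E)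
    (h0 : Ψ ≠ 0) :
    ∃ b : OrthonormalBasis (Fin (Module.finrank ℂ E)) ℂ E, Ψ ∈ mpsSet (fun _ => 3) b := by
  obtain ⟨L, hL⟩ : ∃ L, L = Module.finrank ℂ E := ⟨_, rfl⟩
  rw [← hL]
  cases L with
  | zero =>
    have b : OrthonormalBasis (Fin 0) ℂ E :=
      (stdOrthonormalBasis ℂ E).reindex (finCongr hL.symm)
    have h := sum_pairForm_smul b hΨ
    rw [Finset.univ_eq_empty, Finset.sum_empty] at h
    exact (h0 ((smul_eq_zero.1 h.symm).resolve_left two_ne_zero)).elim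
  | succ n =>
    have : Nontrivial E := Module.nontrivial_of_finrank_pos (R := ℂ) (by omega)
    obtain ⟨u, hu⟩ := exists_norm_eq E zero_le_one
    obtain ⟨b, -, hb⟩ := exists_orthonormalBasis_tridiagonal n hL.symm (pairForm Ψ) u hu
    refine ⟨b, ?_⟩
    have h := sum_pairForm_smul b hΨ
    rw [sum_sum_eq_of_tridiagonal, ← Nat.cast_smul_eq_nsmul ℂ] at h
    · have h' := smul_right_injective (Fock E) (two_ne_zero (α := ℂ)) h
      have := sum_pairs_mem_mpsSet b fun k => if hk : k < n then
        conj (pairForm Ψ (b (⟨k, hk⟩ : Fin n).castSucc) (b (⟨k, hk⟩ : Fin n).succ)) else 0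
      rw [← h']
      simpa using this
    · intro i j
      have hB : pairForm Ψ (b i) (b j) = - pairForm Ψ (b j) (b i) :=
        (LinearMap.IsAlt.neg (pairForm_self Ψ) _ _).symm
      rw [hB, eq_neg_of_add_eq_zero_left (ExteriorAlgebra.ι_add_mul_swap (b i) (b j)), map_neg,
        neg_smul_neg]
    · simp [pairForm_self]
    · intro i j hij
      rw [hb i j hij, map_zero, zero_smul]

/-! ### Minimizers of the energy on invariant subspaces -/

section Symmetric

variable {V : Type*} [NormedAddCommGroup V] [InnerProductSpace ℂ V]

/-- First variation in the direction of the residual `x = T w - m w`, which lies in `K` by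
invariance: the form `⟨u, T u⟩ - m ‖u‖²` is nonnegative on `K` and vanishes at `w`, while its linear
term along `x` is `2 t ‖x‖²`. -/
theorem eq_smul_of_re_inner_eq {T : V →ₗ[ℂ] V} (hT : T.IsSymmetric) {K : Submodule ℂ V}
    (hK : ∀ x ∈ K, T x ∈ K) {m : ℝ} (hm : ∀ u ∈ K, m * ‖u‖ ^ 2 ≤ (inner ℂ u (T u)).re)
    {w : V} (hw : w ∈ K) (h : (inner ℂ w (T w)).re = m * ‖w‖ ^ 2) : T w = (m : ℂ) • w := by
  set x := T w - (m : ℂ) • w with hx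
  have hxK : x ∈ K := K.sub_mem (hK w hw) (K.smul_mem _ hw)
  have hxT : (inner ℂ x (T w)).re - m * (inner ℂ x w).re = ‖x‖ ^ 2 := by
    have : (inner ℂ x x).re = ‖x‖ ^ 2 := (norm_sq_eq_re_inner (𝕜 := ℂ) x).symm
    rw [← this]
    conv_rhs => rw [hx, inner_sub_right, inner_smul_right, Complex.sub_re, Complex.re_ofReal_mul]
  have hsymm : (inner ℂ w (T x)).re = (inner ℂ x (T w)).re := by
    rw [← hT, ← inner_conj_symm, Complex.conj_re]
  have hquad (t : ℝ) : 0 ≤ 2 * t * ‖x‖ ^ 2 +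
      t ^ 2 * ((inner ℂ x (T x)).re - m * ‖x‖ ^ 2) := by
    have h₁ := hm (w + (t : ℂ) • x) (K.add_mem hw (K.smul_mem _ hxK))
    have h₂ : ‖w + (t : ℂ) • x‖ ^ 2 =
        ‖w‖ ^ 2 + 2 * t * (inner ℂ x w).re + t ^ 2 * ‖x‖ ^ 2 := by
      rw [norm_add_sq (𝕜 := ℂ), norm_smul, inner_smul_right, ← inner_conj_symm w x, mul_pow, Complex.norm_real,
        Real.norm_eq_abs, sq_abs, RCLike.re_to_complex, Complex.re_ofReal_mul, Complex.conj_re]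
      ring
    rw [h₂] at h₁
    simp only [map_add, map_smul, inner_add_left, inner_add_right, inner_smul_left,
      inner_smul_right, Complex.conj_ofReal, Complex.add_re, Complex.re_ofReal_mul, hsymm, h] at h₁
    linear_combination h₁ + 2 * t * hxT
  suffices x = 0 from sub_eq_zero.1 this
  by_contra hne
  have ha : 0 < ‖x‖ ^ 2 := by positivity
  set β := (inner ℂ x (T x)).re - m * ‖x‖ ^ 2 with hβ
  have hβ0 : 0 ≤ β := sub_nonneg.2 (hm x hxK)
  -- A small negative `t` makes the quadratic negative; the `+ 1` keeps the denominator positive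
  -- when `β = 0`.
  have h' := hquad (-(‖x‖ ^ 2 / (β + 1)))
  have h1 : ‖x‖ ^ 2 / (β + 1) > 0 := by positivity
  have h2 : ‖x‖ ^ 2 / (β + 1) * (β + 1) = ‖x‖ ^ 2 := by field_simp
  nlinarith

/-- The energy attains its minimum on the compact unit sphere of `K`; rescaling extends the bound to
all of `K`. -/
theorem exists_eigenvector_le_re_inner [FiniteDimensional ℂ V] {T : V →ₗ[ℂ] V}
    (hT : T.IsSymmetric) {K : Submodule ℂ V} (hK : ∀ x ∈ K, T x ∈ K) (hne : K ≠ ⊥) :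
    ∃ w ∈ K, w ≠ 0 ∧ ∃ m : ℝ, T w = (m : ℂ) • w ∧
      ∀ u ∈ K, m * ‖u‖ ^ 2 ≤ (inner ℂ u (T u)).re := by
  have := FiniteDimensional.proper_rclike ℂ V
  obtain ⟨v, hv, hv0⟩ := K.ne_bot_iff.1 hne
  have hcomp : IsCompact (Metric.sphere (0 : V) 1 ∩ K) :=
    (isCompact_sphere _ _).inter_right K.closed_of_finiteDimensional
  have hscale (u : V) (hu0 : u ≠ 0) (hu : u ∈ K) :
      ((‖u‖⁻¹ : ℝ) : ℂ) • u ∈ Metric.sphere (0 : V) 1 ∩ K := by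
    refine ⟨?_, K.smul_mem _ hu⟩
    simp [norm_smul, hu0]
  have hcont : Continuous fun u : V => (inner ℂ u (T u)).re :=
    Complex.continuous_re.comp (continuous_id.inner T.continuous_of_finiteDimensional)
  obtain ⟨w, ⟨hw1, hwK⟩, hmin⟩ := hcomp.exists_isMinOn ⟨_, hscale v hv0 hv⟩ hcont.continuousOn
  have hw1 : ‖w‖ = 1 := by simpa using hw1
  have hm : ∀ u ∈ K, (inner ℂ w (T w)).re * ‖u‖ ^ 2 ≤ (inner ℂ u (T u)).re := by
    intro u hu
    by_cases hu0 : u = 0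
    · simp [hu0]
    have h := hmin (hscale u hu0 hu)
    simp only [Set.mem_ofPred_eq, map_smul, inner_smul_left, inner_smul_right, Complex.conj_ofReal,
      Complex.re_ofReal_mul] at h
    have hpos : 0 < ‖u‖ := norm_pos_iff.2 hu0
    calc (inner ℂ w (T w)).re * ‖u‖ ^ 2
        ≤ (‖u‖⁻¹ * (‖u‖⁻¹ * (inner ℂ u (T u)).re)) * ‖u‖ ^ 2 := by gcongr
      _ = (inner ℂ u (T u)).re := by field_simp
  exact ⟨w, hwK, by rintro rfl; simp at hw1, _,
    eq_smul_of_re_inner_eq hT hK hm hwK (by simp [hw1]), hm⟩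

end Symmetric

/-- `Φ` is an eigenvector of `H` that minimizes the energy, with minimum `m`, among the
two-particle states orthogonal to `Ψ 0, …, Ψ (j - 1)`. -/
structure IsGroundState (H : Module.End ℂ (Fock E)) (Ψ : ℕ → Fock E) (j : ℕ) (Φ : Fock E)
    (m : ℝ) : Prop where
  mem : Φ ∈ ⋀[ℂ]^2 E
  ne_zero : Φ ≠ 0
  orthogonal : ∀ k < j, fockInner (Ψ k) Φ = 0
  apply_eq : H Φ = (m : ℂ) • Φ
  le : ∀ u ∈ ⋀[ℂ]^2 E, (∀ k < j, fockInner (Ψ k) u = 0) →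
    m * (fockInner u u).re ≤ (fockInner u (H u)).re

theorem IsGroundState.congr {H : Module.End ℂ (Fock E)} {Ψ Ψ' : ℕ → Fock E} {j : ℕ} {Φ : Fock E}
    {m : ℝ} (h : IsGroundState H Ψ j Φ m) (hΨ : ∀ k < j, Ψ k = Ψ' k) :
    IsGroundState H Ψ' j Φ m where
  mem := h.mem
  ne_zero := h.ne_zero
  orthogonal k hk := hΨ k hk ▸ h.orthogonal k hk
  apply_eq := h.apply_eq
  le u hu hu' := h.le u hu fun k hk => (hΨ k hk).symm ▸ hu' k hk

/-- The two-particle states orthogonal to `Ψ 0, …, Ψ (j - 1)`. -/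
def orthogonalSector (Ψ : ℕ → Fock E) (j : ℕ) : Submodule ℂ (⋀[ℂ]^2 E) :=
  LinearMap.ker (LinearMap.pi fun k : Fin j =>
    (⟨⟨fockInner (Ψ k), fockInner_add_right _⟩, fun c => fockInner_smul_right c _⟩ :
      Fock E →ₗ[ℂ] ℂ) ∘ₗ (⋀[ℂ]^2 E).subtype)

theorem mem_orthogonalSector {Ψ : ℕ → Fock E} {j : ℕ} {x : ⋀[ℂ]^2 E} :
    x ∈ orthogonalSector Ψ j ↔ ∀ k < j, fockInner (Ψ k) x = 0 := by
  simp only [orthogonalSector, LinearMap.mem_ker, funext_iff, LinearMap.pi_apply]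
  exact ⟨fun h k hk => h ⟨k, hk⟩, fun h k => h k k.2⟩

variable {H : Module.End ℂ (Fock E)}

theorem re_fockInner_eq_smul {H : Module.End ℂ (Fock E)} {Φ : Fock E} {m : ℝ}
    (h : H Φ = (m : ℂ) • Φ) : (fockInner Φ (H Φ)).re = m * (fockInner Φ Φ).re := by
  rw [h, fockInner_smul_right, Complex.re_ofReal_mul]

/-- Exactness of the lower levels enters here: for an eigenvector `Ψ k`, `⟨Ψ k, H x⟩ = e k ⟨Ψ k,
x⟩`. -/
theorem restrict_mem_orthogonalSector (hself : IsSelfAdjointOp H) (hcons : IsNumberConserving H)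
    {Ψ : ℕ → Fock E} {j : ℕ} {e : ℕ → ℝ} (hΨ : ∀ k < j, IsGroundState H Ψ k (Ψ k) (e k))
    (x : ⋀[ℂ]^2 E) (hx : x ∈ orthogonalSector Ψ j) :
    H.restrict (hcons 2) x ∈ orthogonalSector Ψ j := by
  rw [mem_orthogonalSector] at hx ⊢
  intro k hk
  rw [LinearMap.coe_restrict_apply, ← hself, (hΨ k hk).apply_eq, fockInner_smul_left, hx k hk,
    mul_zero]

theorem trialSet_congr {L : ℕ} (r : ℕ → ℕ) (N : ℕ) {Ψ Ψ' : ℕ → Fock E} {j : ℕ}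
    (h : ∀ k < j, Ψ k = Ψ' k) (b : OrthonormalBasis (Fin L) ℂ E) :
    trialSet r N Ψ j b = trialSet r N Ψ' j b := by
  ext Φ
  exact and_congr_right fun _ => and_congr_right fun _ => and_congr_right fun _ =>
    forall₂_congr fun k hk => by rw [h k hk]

theorem isOptimizerMO_congr {r : ℕ → ℕ} {N : ℕ} {Ψ Ψ' : ℕ → Fock E} {j : ℕ}
    (h : ∀ k < j, Ψ k = Ψ' k) {Φ : Fock E} :
    IsOptimizerMO H r N Ψ j Φ ↔ IsOptimizerMO H r N Ψ' j Φ := by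
  simp only [IsOptimizerMO, IsEnergyMO, IsEnergy, trialSet_congr r N h]

section FiniteDimensional

variable [FiniteDimensional ℂ E]

theorem finrank_exteriorPower_two :
    Module.finrank ℂ (⋀[ℂ]^2 E) = (Module.finrank ℂ E).choose 2 :=
  exteriorPower.finrank_eq ℂ 2

/-- Fewer linear conditions than dimensions. -/
theorem exists_orthogonal {Ψ : ℕ → Fock E} {j : ℕ} (hj : j < (Module.finrank ℂ E).choose 2) :
    ∃ Φ ∈ ⋀[ℂ]^2 E, Φ ≠ 0 ∧ ∀ k < j, fockInner (Ψ k) Φ = 0 := by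
  have h : orthogonalSector Ψ j ≠ ⊥ :=
    LinearMap.ker_ne_bot_of_finrank_lt (by simpa [finrank_exteriorPower_two] using hj)
  obtain ⟨x, hx, hx0⟩ := (Submodule.ne_bot_iff _).1 h
  exact ⟨x, x.2, fun h => hx0 (Subtype.ext h), mem_orthogonalSector.1 hx⟩

theorem re_fockInner_self_pos {Ψ : Fock E} (hΨ : Ψ ∈ ⋀[ℂ]^2 E) (h0 : Ψ ≠ 0) :
    0 < (fockInner Ψ Ψ).re := by
  refine (re_fockInner_self_nonneg hΨ).lt_of_ne' fun h => h0 (eq_zero_of_fockInner_self hΨ ?_)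
  exact Complex.ext h (Complex.conj_eq_iff_im.1 (fockInner_conj_symm hΨ hΨ))

theorem exists_isGroundState (hself : IsSelfAdjointOp H) (hcons : IsNumberConserving H)
    {Ψ : ℕ → Fock E} {j : ℕ} {e : ℕ → ℝ} (hΨ : ∀ k < j, IsGroundState H Ψ k (Ψ k) (e k))
    {Φ : Fock E} (hΦ : Φ ∈ ⋀[ℂ]^2 E) (h0 : Φ ≠ 0) (horth : ∀ k < j, fockInner (Ψ k) Φ = 0) :
    ∃ Φ' m, IsGroundState H Ψ j Φ' m := by
  let : NormedAddCommGroup (⋀[ℂ]^2 E) := (pairCore E).toNormedAddCommGroup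
  let : InnerProductSpace ℂ (⋀[ℂ]^2 E) := InnerProductSpace.ofCore (pairCore E).toCore
  have hnorm (x : ⋀[ℂ]^2 E) : ‖x‖ ^ 2 = (fockInner (x : Fock E) x).re :=
    norm_sq_eq_re_inner (𝕜 := ℂ) x
  have hT : (H.restrict (hcons 2)).IsSymmetric := fun x y => hself x y
  obtain ⟨w, hw, hw0, m, hwm, hm⟩ := exists_eigenvector_le_re_inner hT
    (restrict_mem_orthogonalSector hself hcons hΨ)
    ((Submodule.ne_bot_iff _).2 ⟨⟨Φ, hΦ⟩, mem_orthogonalSector.2 horth,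
      fun h => h0 (congrArg Subtype.val h)⟩)
  refine ⟨w, m, w.2, fun h => hw0 (Subtype.ext h), mem_orthogonalSector.1 hw,
    congrArg Subtype.val hwm, fun u hu hu' => ?_⟩
  have := hm ⟨u, hu⟩ (mem_orthogonalSector.2 hu')
  rwa [hnorm] at this

theorem IsGroundState.apply_eq_of_re_eq (hself : IsSelfAdjointOp H) (hcons : IsNumberConserving H)
    {Ψ : ℕ → Fock E} {j : ℕ} {e : ℕ → ℝ} (hΨ : ∀ k < j, IsGroundState H Ψ k (Ψ k) (e k))
    {Φ₀ Φ : Fock E} {m : ℝ} (h₀ : IsGroundState H Ψ j Φ₀ m) (hΦ : Φ ∈ ⋀[ℂ]^2 E)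
    (horth : ∀ k < j, fockInner (Ψ k) Φ = 0)
    (h : (fockInner Φ (H Φ)).re = m * (fockInner Φ Φ).re) : H Φ = (m : ℂ) • Φ := by
  let : NormedAddCommGroup (⋀[ℂ]^2 E) := (pairCore E).toNormedAddCommGroup
  let : InnerProductSpace ℂ (⋀[ℂ]^2 E) := InnerProductSpace.ofCore (pairCore E).toCore
  have hnorm (x : ⋀[ℂ]^2 E) : ‖x‖ ^ 2 = (fockInner (x : Fock E) x).re :=
    norm_sq_eq_re_inner (𝕜 := ℂ) x
  have hT : (H.restrict (hcons 2)).IsSymmetric := fun x y => hself x y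
  have := eq_smul_of_re_inner_eq hT (m := m) (w := ⟨Φ, hΦ⟩)
    (restrict_mem_orthogonalSector hself hcons hΨ)
    (fun u hu => by
      rw [hnorm]
      exact h₀.le u u.2 (mem_orthogonalSector.1 hu))
    (mem_orthogonalSector.2 horth) (by rw [hnorm]; exact h)
  exact congrArg Subtype.val this

/-! ### Exact energies -/

theorem linearIndependent_of_isGroundState {Ψ : ℕ → Fock E} {n : ℕ} {e : ℕ → ℝ}
    (hΨ : ∀ k < n, IsGroundState H Ψ k (Ψ k) (e k)) :
    LinearIndependent ℂ fun k : Fin n => Ψ k := by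
  let : NormedAddCommGroup (⋀[ℂ]^2 E) := (pairCore E).toNormedAddCommGroup
  let : InnerProductSpace ℂ (⋀[ℂ]^2 E) := InnerProductSpace.ofCore (pairCore E).toCore
  have hlt (k l : ℕ) (hk : k < n) (hl : l < n) (h : k < l) :
      inner ℂ (⟨Ψ k, (hΨ k hk).mem⟩ : ⋀[ℂ]^2 E) ⟨Ψ l, (hΨ l hl).mem⟩ = 0 :=
    (hΨ l hl).orthogonal k h
  have h : LinearIndependent ℂ fun k : Fin n => (⟨Ψ k, (hΨ k k.2).mem⟩ : ⋀[ℂ]^2 E) := by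
    refine linearIndependent_of_ne_zero_of_inner_eq_zero
      (fun k h => (hΨ k k.2).ne_zero (congrArg Subtype.val h)) fun k l hkl => ?_
    rcases lt_or_gt_of_ne hkl with h | h
    · exact hlt k l k.2 l.2 h
    · exact inner_eq_zero_symm.1 (hlt l k l.2 k.2 h)
  exact h.map' (⋀[ℂ]^2 E).subtype (Submodule.ker_subtype _)

theorem IsGroundState.le_of_le {Ψ : ℕ → Fock E} {k j : ℕ} (hkj : k ≤ j) {Φ Φ' : Fock E}
    {m m' : ℝ} (h : IsGroundState H Ψ k Φ m) (h' : IsGroundState H Ψ j Φ' m') : m ≤ m' := by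
  have := h.le Φ' h'.mem fun l hl => h'.orthogonal l (hl.trans_le hkj)
  rw [re_fockInner_eq_smul h'.apply_eq] at this
  exact le_of_mul_le_mul_right this (re_fockInner_self_pos h'.mem h'.ne_zero)

/-- Let `p` be the orthogonal projection of `w` to the span. Then `w - p` satisfies the eigenvalue
equation for `x` and is orthogonal to all `Ψ k`; minimality of `m > x` forces it to vanish. -/
theorem mem_span_of_eigenvalue_lt (hself : IsSelfAdjointOp H) {Ψ : ℕ → Fock E} {j : ℕ}
    {e : ℕ → ℝ} (hΨ : ∀ k < j, IsGroundState H Ψ k (Ψ k) (e k)) {Φ : Fock E} {m : ℝ}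
    (hΦ : IsGroundState H Ψ j Φ m) {w : Fock E} (hw : w ∈ ⋀[ℂ]^2 E) {x : ℝ}
    (hwx : H w = (x : ℂ) • w) (hx : x < m) :
    w ∈ Submodule.span ℂ (Set.range fun k : Fin j => Ψ k) := by
  set a : Fin j → ℂ := fun k => fockInner (Ψ k) w / fockInner (Ψ k) (Ψ k) with ha
  set p := ∑ k : Fin j, a k • Ψ k with hp
  have hpspan : p ∈ Submodule.span ℂ (Set.range fun k : Fin j => Ψ k) :=
    Submodule.sum_mem _ fun k _ => Submodule.smul_mem _ _ (Submodule.subset_span ⟨k, rfl⟩)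
  have hpmem : p ∈ ⋀[ℂ]^2 E :=
    Submodule.sum_mem _ fun k _ => Submodule.smul_mem _ _ (hΨ k k.2).mem
  -- Eigenvectors for different eigenvalues are orthogonal, so `a k = 0` unless `e k = x`.
  have hcoef (k : Fin j) : a k • H (Ψ k) = (x : ℂ) • a k • Ψ k := by
    have h : (e k : ℂ) * fockInner (Ψ k) w = x * fockInner (Ψ k) w := by
      rw [← fockInner_smul_right (x : ℂ), ← hwx, ← hself, (hΨ k k.2).apply_eq,
        fockInner_smul_left, Complex.conj_ofReal]
    rw [(hΨ k k.2).apply_eq, smul_smul, smul_smul, ha]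
    congr 1
    linear_combination h / fockInner (Ψ k) (Ψ k)
  have hHp : H p = (x : ℂ) • p := by
    simp only [hp, map_sum, map_smul, hcoef, Finset.smul_sum]
  have horth (k : ℕ) (hk : k < j) : fockInner (Ψ k) (w - p) = 0 := by
    have hne : fockInner (Ψ k) (Ψ k) ≠ 0 := fun h =>
      (hΨ k hk).ne_zero (eq_zero_of_fockInner_self (hΨ k hk).mem h)
    have hkp : fockInner (Ψ k) p = fockInner (Ψ k) w := by
      rw [hp, fockInner_sum_right, Finset.sum_eq_single ⟨k, hk⟩]
      · rw [fockInner_smul_right, ha, div_mul_cancel₀ _ hne]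
      · intro l _ hl
        rw [fockInner_smul_right]
        have hl' : (l : ℕ) ≠ k := fun h => hl (Fin.ext h)
        rcases lt_or_gt_of_ne hl' with h | h
        · rw [← fockInner_conj_symm (hΨ k hk).mem (hΨ l l.2).mem, (hΨ k hk).orthogonal l h,
            map_zero, mul_zero]
        · rw [(hΨ l l.2).orthogonal k h, mul_zero]
      · simp
    rw [sub_eq_add_neg, ← neg_one_smul ℂ p, fockInner_add_right, fockInner_smul_right, hkp]
    ring
  have hzero : w - p = 0 := by
    by_contra hne
    have hmem := (⋀[ℂ]^2 E).sub_mem hw hpmem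
    have h := hΦ.le _ hmem horth
    rw [re_fockInner_eq_smul (m := x) (by rw [map_sub, hwx, hHp, smul_sub])] at h
    exact hx.not_ge (le_of_mul_le_mul_right h (re_fockInner_self_pos hmem hne))
  rw [sub_eq_zero.1 hzero]
  exact hpspan

/-- Eigenvectors below `m` lie in the span of `j` vectors, whereas these together with `Φ` are `j +
1` independent eigenvectors with eigenvalues at most `m`. -/
theorem IsGroundState.isExactEnergy (hself : IsSelfAdjointOp H) {Ψ : ℕ → Fock E} {j : ℕ}
    {e : ℕ → ℝ} (hΨ : ∀ k < j, IsGroundState H Ψ k (Ψ k) (e k)) {Φ : Fock E} {m : ℝ}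
    (hΦ : IsGroundState H Ψ j Φ m) : IsExactEnergy H 2 j m := by
  constructor
  · have hle : (⨆ x : ℝ, ⨆ _ : x < m, (⋀[ℂ]^2 E ⊓ Module.End.eigenspace H (x : ℂ))) ≤
        Submodule.span ℂ (Set.range fun k : Fin j => Ψ k) :=
      iSup₂_le fun x hx w hw =>
        mem_span_of_eigenvalue_lt hself hΨ hΦ hw.1 (Module.End.mem_eigenspace_iff.1 hw.2) hx
    calc _ ≤ Module.finrank ℂ (Submodule.span ℂ (Set.range fun k : Fin j => Ψ k)) := by
          have : Module.Finite ℂ (Submodule.span ℂ (Set.range fun k : Fin j => Ψ k)) :=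
            FiniteDimensional.span_of_finite ℂ (Set.finite_range _)
          exact Submodule.finrank_mono hle
      _ ≤ j := by simpa [Set.finrank] using finrank_range_le_card (R := ℂ) fun k : Fin j => Ψ k
  · have hΨ' (k : ℕ) (hk : k < j + 1) : IsGroundState H (Function.update Ψ j Φ) k
        (Function.update Ψ j Φ k) (Function.update e j m k) := by
      have hcongr (l : ℕ) (hl : l < k) : Ψ l = Function.update Ψ j Φ l :=
        (Function.update_of_ne (by omega) _ _).symm
      rcases Nat.lt_succ_iff_lt_or_eq.1 hk with h | rfl
      · rw [Function.update_of_ne h.ne, Function.update_of_ne h.ne]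
        exact (hΨ k h).congr hcongr
      · rw [Function.update_self, Function.update_self]
        exact hΦ.congr hcongr
    set S := ⨆ x : ℝ, ⨆ _ : x ≤ m, (⋀[ℂ]^2 E ⊓ Module.End.eigenspace H (x : ℂ)) with hS
    have hSle : S ≤ ⋀[ℂ]^2 E := iSup₂_le fun x _ => inf_le_left
    have : Module.Finite ℂ S := Submodule.finiteDimensional_of_le hSle
    have hmem (k : Fin (j + 1)) : Function.update Ψ j Φ k ∈ S := by
      have hk := hΨ' k k.2
      have hle : Function.update e j m k ≤ m := by
        have := hk.le_of_le (Nat.lt_succ_iff.1 k.2) (hΨ' j (by omega))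
        rwa [Function.update_self] at this
      exact Submodule.mem_iSup_of_mem _ (Submodule.mem_iSup_of_mem hle
        ⟨hk.mem, Module.End.mem_eigenspace_iff.2 hk.apply_eq⟩)
    have hli : LinearIndependent ℂ fun k : Fin (j + 1) => (⟨_, hmem k⟩ : S) :=
      LinearIndependent.of_comp S.subtype (linearIndependent_of_isGroundState hΨ')
    simpa using hli.fintype_card_le_finrank

theorem finrank_iSup_eigenspace_mono {p q : ℝ → Prop} (h : ∀ x, p x → q x) :
    Module.finrank ℂ ↥(⨆ x : ℝ, ⨆ _ : p x, (⋀[ℂ]^2 E ⊓ Module.End.eigenspace H (x : ℂ))) ≤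
      Module.finrank ℂ
        ↥(⨆ x : ℝ, ⨆ _ : q x, (⋀[ℂ]^2 E ⊓ Module.End.eigenspace H (x : ℂ))) := by
  have : Module.Finite ℂ
      ↥(⨆ x : ℝ, ⨆ _ : q x, (⋀[ℂ]^2 E ⊓ Module.End.eigenspace H (x : ℂ))) :=
    Submodule.finiteDimensional_of_le (iSup₂_le fun x _ => inf_le_left : _ ≤ ⋀[ℂ]^2 E)
  exact Submodule.finrank_mono (iSup_mono fun x => iSup_mono' fun hx => ⟨h x hx, le_rfl⟩)

/-- If `e < e'`, the more than `j` eigenvalues `≤ e` would be among the at most `j` eigenvalues `<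
e'`. -/
theorem IsExactEnergy.unique {j : ℕ} {e e' : ℝ} (h : IsExactEnergy H 2 j e)
    (h' : IsExactEnergy H 2 j e') : e = e' := by
  by_contra hne
  rcases lt_or_gt_of_ne hne with hlt | hlt
  · exact (h.2.trans_le ((finrank_iSup_eigenspace_mono fun x hx => hx.trans_lt hlt).trans
      h'.1)).false
  · exact (h'.2.trans_le ((finrank_iSup_eigenspace_mono fun x hx => hx.trans_lt hlt).trans
      h.1)).false

theorem IsExactEnergy.lt_choose {j : ℕ} {e : ℝ} (h : IsExactEnergy H 2 j e) :
    j < (Module.finrank ℂ E).choose 2 := by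
  rw [← finrank_exteriorPower_two]
  exact h.2.trans_le (Submodule.finrank_mono (iSup₂_le fun x _ => inf_le_left))

/-! ### Exactness of mode-optimized QC-DMRG -/

variable {Ψ : ℕ → Fock E} {j : ℕ} {Φ : Fock E} {m : ℝ}

theorem IsGroundState.rayleigh_eq (hΦ : IsGroundState H Ψ j Φ m) : rayleigh H Φ = m := by
  rw [rayleigh, re_fockInner_eq_smul hΦ.apply_eq,
    mul_div_cancel_right₀ _ (re_fockInner_self_pos hΦ.mem hΦ.ne_zero).ne']

theorem IsGroundState.le_rayleigh (hΦ : IsGroundState H Ψ j Φ m) {L : ℕ} {r : ℕ → ℕ}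
    {b : OrthonormalBasis (Fin L) ℂ E} {u : Fock E} (hu : u ∈ trialSet r 2 Ψ j b) :
    m ≤ rayleigh H u := by
  obtain ⟨-, hu0, humem, hu⟩ := hu
  rw [rayleigh, le_div_iff₀ (re_fockInner_self_pos humem hu0)]
  exact hΦ.le u humem hu

/-- In a basis adapted to `Φ` the unrestricted minimizer is itself a trial state, so the minimum in
that basis exists without any compactness of the set of matrix product states. -/
theorem IsGroundState.isOptimizerMO (hΦ : IsGroundState H Ψ j Φ m) :
    IsOptimizerMO H (fun _ => 3) 2 Ψ j Φ := by
  obtain ⟨b, hb⟩ := exists_mem_mpsSet hΦ.mem hΦ.ne_zero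
  have htrial : Φ ∈ trialSet (fun _ => 3) 2 Ψ j b := ⟨hb, hΦ.ne_zero, hΦ.mem, hΦ.orthogonal⟩
  have hE : IsEnergy H (fun _ => 3) 2 Ψ j b (rayleigh H Φ) := by
    refine ⟨⟨Φ, htrial, rfl⟩, ?_⟩
    rintro _ ⟨u, hu, rfl⟩
    exact hΦ.rayleigh_eq ▸ hΦ.le_rayleigh hu
  refine ⟨b, htrial, hE, ⟨b, hE⟩, ?_⟩
  rintro _ ⟨b', ⟨u, hu, rfl⟩, -⟩
  exact hΦ.rayleigh_eq ▸ hΦ.le_rayleigh hu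

theorem IsGroundState.isEnergyMO_iff (hΦ : IsGroundState H Ψ j Φ m) {e : ℝ} :
    IsEnergyMO H (fun _ => 3) 2 Ψ j e ↔ e = m := by
  obtain ⟨b, -, -, hMO⟩ := hΦ.isOptimizerMO
  rw [hΦ.rayleigh_eq] at hMO
  exact ⟨fun h => IsLeast.unique h hMO, fun h => h ▸ hMO⟩

/-- Any optimizer attains the unrestricted minimum `m`, and equality in the variational bound makes
it an eigenvector. -/
theorem IsGroundState.of_isOptimizerMO (hself : IsSelfAdjointOp H) (hcons : IsNumberConserving H)
    {e : ℕ → ℝ} (hΨ : ∀ k < j, IsGroundState H Ψ k (Ψ k) (e k)) {Φ₀ : Fock E}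
    (h₀ : IsGroundState H Ψ j Φ₀ m) (h : IsOptimizerMO H (fun _ => 3) 2 Ψ j Φ) :
    IsGroundState H Ψ j Φ m := by
  obtain ⟨b, ⟨-, h0, hmem, horth⟩, -, hMO⟩ := h
  have hr := h₀.isEnergyMO_iff.1 hMO
  rw [rayleigh, div_eq_iff (re_fockInner_self_pos hmem h0).ne'] at hr
  exact ⟨hmem, h0, horth, h₀.apply_eq_of_re_eq hself hcons hΨ hmem horth hr, h₀.le⟩

theorem IsRunMO.exists_isGroundState (hself : IsSelfAdjointOp H) (hcons : IsNumberConserving H)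
    (hΨ : IsRunMO H (fun _ => 3) 2 Ψ j) :
    ∃ e : ℕ → ℝ, ∀ k < j, IsGroundState H Ψ k (Ψ k) (e k) := by
  induction j with
  | zero => exact ⟨0, fun k hk => absurd hk k.not_lt_zero⟩
  | succ j ih =>
    obtain ⟨e, he⟩ := ih fun k hk => hΨ k (by omega)
    have hj := hΨ j (by omega)
    obtain ⟨b, ⟨-, h0, hmem, horth⟩, -⟩ := id hj
    -- The optimizer only witnesses that the orthogonal sector is nonzero; `Φ₀` supplies the minimum
    -- to compare with.
    obtain ⟨Φ₀, m, h₀⟩ := QCDMRG.exists_isGroundState hself hcons he hmem h0 horth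
    refine ⟨Function.update e j m, fun k hk => ?_⟩
    rcases Nat.lt_succ_iff_lt_or_eq.1 hk with h | rfl
    · rw [Function.update_of_ne h.ne]
      exact he k h
    · rw [Function.update_self]
      exact h₀.of_isOptimizerMO hself hcons he hj

theorem exists_isRunMO (hself : IsSelfAdjointOp H) (hcons : IsNumberConserving H) (n : ℕ)
    (hn : n ≤ (Module.finrank ℂ E).choose 2) :
    ∃ Ψ : ℕ → Fock E, IsRunMO H (fun _ => 3) 2 Ψ n := by
  induction n with
  | zero => exact ⟨0, fun k hk => absurd hk k.not_lt_zero⟩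
  | succ n ih =>
    obtain ⟨Ψ, hΨ⟩ := ih (by omega)
    obtain ⟨e, he⟩ := hΨ.exists_isGroundState hself hcons
    obtain ⟨Φ, hmem, h0, horth⟩ := exists_orthogonal (Ψ := Ψ) hn
    obtain ⟨Φ₀, m, h₀⟩ := QCDMRG.exists_isGroundState hself hcons he hmem h0 horth
    refine ⟨Function.update Ψ n Φ₀, fun k hk => ?_⟩
    -- Optimality at level `k ≤ n` involves only states below `k`, which the update at `n` leaves
    -- unchanged.
    rw [isOptimizerMO_congr (Ψ' := Ψ) fun l hl => Function.update_of_ne (by omega) _ _]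
    rcases Nat.lt_succ_iff_lt_or_eq.1 hk with h | rfl
    · rw [Function.update_of_ne h.ne]
      exact hΨ k h
    · rw [Function.update_self]
      exact h₀.isOptimizerMO

end FiniteDimensional

end QCDMRG

end

theorem theorem3 {E : Type*} [NormedAddCommGroup E] [InnerProductSpace ℂ E]
    [FiniteDimensional ℂ E]
    (H : Module.End ℂ (QCDMRG.Fock E))
    (hself : QCDMRG.IsSelfAdjointOp H) (hcons : QCDMRG.IsNumberConserving H) (j : ℕ) :
    (j < (Module.finrank ℂ E).choose 2 →
      ∃ Ψ : ℕ → QCDMRG.Fock E, QCDMRG.IsRunMO H (fun _ => 3) 2 Ψ (j + 1)) ∧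
    ∀ Ψ : ℕ → QCDMRG.Fock E, QCDMRG.IsRunMO H (fun _ => 3) 2 Ψ j →
      (∀ e : ℝ, QCDMRG.IsEnergyMO H (fun _ => 3) 2 Ψ j e ↔ QCDMRG.IsExactEnergy H 2 j e) ∧
      ∀ Φ : QCDMRG.Fock E, QCDMRG.IsOptimizerMO H (fun _ => 3) 2 Ψ j Φ →
        ∃ e : ℝ, QCDMRG.IsExactEnergy H 2 j e ∧ H Φ = (e : ℂ) • Φ := by
  refine ⟨fun hj => QCDMRG.exists_isRunMO hself hcons (j + 1) hj, fun Ψ hΨ => ?_⟩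
  obtain ⟨ε, hε⟩ := hΨ.exists_isGroundState hself hcons
  refine ⟨fun e => ⟨fun h => ?_, fun h => ?_⟩, fun Φ hΦ => ?_⟩
  · obtain ⟨b, ⟨Φ, ⟨-, h0, hmem, horth⟩, -⟩, -⟩ := h.1
    obtain ⟨Φ₀, m, h₀⟩ := QCDMRG.exists_isGroundState hself hcons hε hmem h0 horth
    rw [h₀.isEnergyMO_iff.1 h]
    exact h₀.isExactEnergy hself hε
  -- An exact energy of index `j` leaves room for a further orthogonal state; uniqueness of exact
  -- energies then identifies `e` with the minimum.
  · obtain ⟨Φ, hmem, h0, horth⟩ := QCDMRG.exists_orthogonal (Ψ := Ψ) h.lt_choose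
    obtain ⟨Φ₀, m, h₀⟩ := QCDMRG.exists_isGroundState hself hcons hε hmem h0 horth
    exact h₀.isEnergyMO_iff.2 (h.unique (h₀.isExactEnergy hself hε))
  · obtain ⟨b, ⟨-, h0, hmem, horth⟩, -⟩ := id hΦ
    obtain ⟨Φ₀, m, h₀⟩ := QCDMRG.exists_isGroundState hself hcons hε hmem h0 horth
    exact ⟨m, h₀.isExactEnergy hself hε, (h₀.of_isOptimizerMO hself hcons hε hΦ).apply_eq⟩
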